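/- Call an element $a$ of a C*-algebra $A$ (unital or not) a zero divisor if there is $c\in A$, $c\neq 0$, with $ac=0$ or $ca=0$. A $Z^*$ algebra is a C*-algebra all of whose positive elements are zero divisors. Let $A$ be a $Z^*$ algebra and let $B$ be any nonzero C*-algebra. Then the minimal (spatial) tensor product $A\otimes_{\min}B$, i.e. the norm closure of the linear span of the operators $\pi(a)\otimes\rho(b)$ ($a\in A$, $b\in B$) on the Hilbert space tensor product $H\otimes K$, where $\pi$ and $\rho$ are the universal (faithful) representations of $A$ on $H$ and of $B$ on $K$, is a $Z^*$ algebra. -/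

import Mathlib

open scoped TensorProduct ENNReal

section PositiveElements

attribute [local instance] CStarAlgebra.spectralOrder CStarAlgebra.spectralOrderedRing

/-- `a` is a (left or right) zero divisor. -/
def IsZeroDivisor {A : Type*} [NonUnitalRing A] (a : A) : Prop :=
  ∃ c : A, c ≠ 0 ∧ (a * c = 0 ∨ c * a = 0)

/-- A `Z*` algebra is a C*-algebra (unital or not) all of whose positive elements are zero divisors.
The order is the usual one of a C*-algebra: `0 ≤ a` iff `a` is self-adjoint with nonnegative
spectrum, equivalently `a = star y * y` for some `y`. -/
def IsZStarAlgebra (A : Type*) [NonUnitalCStarAlgebra A] : Prop :=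
  ∀ a : A, 0 ≤ a → IsZeroDivisor a

end PositiveElements

section DirectSum

variable {A : Type*} [NonUnitalCStarAlgebra A]
variable {ι : Type*} {E : ι → Type*} [∀ i, NormedAddCommGroup (E i)]
  [∀ i, InnerProductSpace ℂ (E i)] [∀ i, CompleteSpace (E i)]

/-- A *-representation of a C*-algebra is contractive. -/
lemma norm_rep_apply_le {H : Type*} [NormedAddCommGroup H] [InnerProductSpace ℂ H]
    [CompleteSpace H] (π : A →⋆ₙₐ[ℂ] (H →L[ℂ] H)) (a : A) (x : H) :
    ‖π a x‖ ≤ ‖a‖ * ‖x‖ :=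
  ((π a).le_opNorm x).trans
    (mul_le_mul_of_nonneg_right (NonUnitalStarAlgHom.norm_apply_le π a) (norm_nonneg x))

lemma memℓp_rep (π : ∀ i, A →⋆ₙₐ[ℂ] (E i →L[ℂ] E i)) (a : A) (x : lp E 2) :
    Memℓp (fun i => π i a (x i)) 2 := by
  refine ((lp.memℓp x).const_smul (‖a‖ : ℂ)).mono' ?_
  intro i
  simpa [norm_smul] using norm_rep_apply_le (π i) a (x i)

/-- The operator `⨁ᵢ πᵢ(a)` on the Hilbert space direct sum `⨁ᵢ Eᵢ`. -/
noncomputable def directSumOp (π : ∀ i, A →⋆ₙₐ[ℂ] (E i →L[ℂ] E i)) (a : A) :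
    lp E 2 →L[ℂ] lp E 2 :=
  LinearMap.mkContinuous
    { toFun := fun x => ⟨fun i => π i a (x i), memℓp_rep π a x⟩
      map_add' := fun x y => by ext i; exact map_add _ _ _
      map_smul' := fun c x => by ext i; simp } ‖a‖ (fun x => by
        have h := lp.norm_mono (p := 2) (by norm_num)
          (x := (⟨fun i => π i a (x i), memℓp_rep π a x⟩ : lp E 2)) (y := (‖a‖ : ℂ) • x)
          (fun i => by
            rw [lp.coeFn_smul, Pi.smul_apply, norm_smul, Complex.norm_real, norm_norm]
            exact norm_rep_apply_le (π i) a (x i))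
        rw [norm_smul, Complex.norm_real, norm_norm] at h
        exact h)

@[simp]
lemma directSumOp_apply (π : ∀ i, A →⋆ₙₐ[ℂ] (E i →L[ℂ] E i)) (a : A) (x : lp E 2) (i : ι) :
    directSumOp π a x i = π i a (x i) := rfl

/-- The direct sum `⨁ᵢ πᵢ` of a family of *-representations. -/
noncomputable def directSumRep (π : ∀ i, A →⋆ₙₐ[ℂ] (E i →L[ℂ] E i)) :
    A →⋆ₙₐ[ℂ] (lp E 2 →L[ℂ] lp E 2) where
  toFun := directSumOp π
  map_smul' c a := by ext x i; simp
  map_zero' := by ext x i; simp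
  map_add' a b := by ext x i; simp
  map_mul' a b := by ext x i; simp
  map_star' a := by
    rw [ContinuousLinearMap.star_eq_adjoint, ContinuousLinearMap.eq_adjoint_iff]
    intro x y
    rw [lp.inner_eq_tsum, lp.inner_eq_tsum]
    congr 1
    ext i
    simp [map_star, ContinuousLinearMap.star_eq_adjoint, ContinuousLinearMap.adjoint_inner_left]

@[simp]
lemma directSumRep_apply (π : ∀ i, A →⋆ₙₐ[ℂ] (E i →L[ℂ] E i)) (a : A) (x : lp E 2) (i : ι) :
    directSumRep π a x i = π i a (x i) := rfl

end DirectSum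

section UniversalRepresentation

open scoped ComplexOrder

variable (A : Type*) [NonUnitalCStarAlgebra A] [PartialOrder A] [StarOrderedRing A]

/-- The Hilbert space of the universal representation: the direct sum of the GNS spaces of all
positive linear functionals on `A`. -/
abbrev UniversalSpace : Type _ := lp (fun f : A →ₚ[ℂ] ℂ => f.GNS) 2

/-- The universal representation of `A`: the direct sum of all its GNS representations. -/
noncomputable def universalRep : A →⋆ₙₐ[ℂ] (UniversalSpace A →L[ℂ] UniversalSpace A) :=
  directSumRep fun f : A →ₚ[ℂ] ℂ => f.gnsNonUnitalStarAlgHom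

variable {A}

/-- Positive linear functionals detect nonzero positive elements. -/
lemma exists_positive_functional {h : A} (hh : 0 ≤ h) (h0 : h ≠ 0) :
    ∃ f : A →ₚ[ℂ] ℂ, f h ≠ 0 := by
  obtain ⟨g, u, hgu, hg⟩ := geometric_hahn_banach_point_closed (x := -h) (t := {a : A | 0 ≤ a})
    (by
      intro x hx y hy a b ha hb _
      exact add_nonneg (smul_nonneg ha hx) (smul_nonneg hb hy))
    CStarAlgebra.isClosed_nonneg
    (fun hn => h0 (le_antisymm (neg_nonneg.mp hn) hh))
  have hu : u < 0 := by simpa using hg 0 le_rfl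
  have hpos : ∀ a : A, 0 ≤ a → 0 ≤ g a := by
    intro a ha
    by_contra! hlt
    have h1 := hg ((u / g a) • a) (smul_nonneg (div_nonneg_of_nonpos hu.le hlt.le) ha)
    rw [map_smul, smul_eq_mul, div_mul_cancel₀ _ hlt.ne] at h1
    exact lt_irrefl _ h1
  let F : A →ₗ[ℂ] ℂ :=
    { toFun := fun a => (g (realPart a : A) : ℂ) + Complex.I * (g (imaginaryPart a : A) : ℂ)
      map_add' := fun a b => by
        simp only [map_add, AddSubgroup.coe_add, Complex.ofReal_add]; ring
      map_smul' := fun c a => by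
        simp only [realPart_smul, imaginaryPart_smul, AddSubgroup.coe_add, AddSubgroup.coe_sub,
          selfAdjoint.val_smul, map_add, map_sub, map_smul, smul_eq_mul, RingHom.id_apply,
          Complex.ofReal_add, Complex.ofReal_sub, Complex.ofReal_mul]
        apply Complex.ext <;> simp }
  have hF : ∀ a : A, IsSelfAdjoint a → F a = (g a : ℂ) := by
    intro a ha
    change (g (realPart a : A) : ℂ) + Complex.I * (g (imaginaryPart a : A) : ℂ) = _
    rw [ha.coe_realPart, ha.imaginaryPart]
    simp
  refine ⟨PositiveLinearMap.mk₀ F fun a ha => ?_, ?_⟩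
  · rw [hF a (.of_nonneg ha)]
    exact_mod_cast hpos a ha
  · change F h ≠ 0
    rw [hF h (.of_nonneg hh)]
    have : g (-h) < 0 := hgu.trans hu
    rw [map_neg] at this
    exact_mod_cast (neg_lt_zero.mp this).ne'

variable (A)

/-- The universal representation is faithful. -/
theorem universalRep_injective : Function.Injective (universalRep A) := by
  rw [injective_iff_map_eq_zero]
  intro c hc
  by_contra hc0
  have hd : c * star c ≠ 0 := by
    simpa [CStarRing.mul_star_self_eq_zero_iff] using hc0
  have hd2 : star (c * star c) * (c * star c) ≠ 0 := by
    rw [Ne, CStarRing.star_mul_self_eq_zero_iff]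
    exact hd
  obtain ⟨f, hf⟩ := exists_positive_functional (star_mul_self_nonneg (c * star c)) hd2
  have h1 : ∀ x : f.GNS, f.gnsNonUnitalStarAlgHom c x = 0 := by
    classical
    intro x
    have h2 := congrArg (fun T => T (lp.single 2 f x) f) hc
    simpa [universalRep] using h2
  have h2 := h1 (f.toPreGNS (star c) : f.GNS)
  rw [PositiveLinearMap.gnsNonUnitalStarAlgHom_apply_coe] at h2
  have h3 : ‖f.leftMulMapPreGNS c (f.toPreGNS (star c))‖ = 0 := by
    rw [← UniformSpace.Completion.norm_coe, h2, norm_zero]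
  have h4 := f.preGNS_norm_sq (f.leftMulMapPreGNS c (f.toPreGNS (star c)))
  rw [h3] at h4
  apply hf
  simpa using h4.symm

end UniversalRepresentation

section SpatialTensorProduct

variable {A B : Type*} [NonUnitalCStarAlgebra A] [NonUnitalCStarAlgebra B]
variable {H K : Type*} [NormedAddCommGroup H] [InnerProductSpace ℂ H] [CompleteSpace H]
  [NormedAddCommGroup K] [InnerProductSpace ℂ K] [CompleteSpace K]

/-- The Hilbert space tensor product: the completion of the algebraic tensor product for
`⟪x ⊗ y, x' ⊗ y'⟫ = ⟪x, x'⟫ * ⟪y, y'⟫`. -/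
def HilbertTensor (H K : Type*) [NormedAddCommGroup H] [InnerProductSpace ℂ H]
    [NormedAddCommGroup K] [InnerProductSpace ℂ K] : Type _ :=
  UniformSpace.Completion (H ⊗[ℂ] K)

section HilbertTensorInstances

variable (H K : Type*) [NormedAddCommGroup H] [InnerProductSpace ℂ H]
  [NormedAddCommGroup K] [InnerProductSpace ℂ K]

noncomputable instance : NormedAddCommGroup (HilbertTensor H K) :=
  inferInstanceAs (NormedAddCommGroup (UniformSpace.Completion (H ⊗[ℂ] K)))

noncomputable instance : InnerProductSpace ℂ (HilbertTensor H K) :=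
  inferInstanceAs (InnerProductSpace ℂ (UniformSpace.Completion (H ⊗[ℂ] K)))

instance : CompleteSpace (HilbertTensor H K) :=
  inferInstanceAs (CompleteSpace (UniformSpace.Completion (H ⊗[ℂ] K)))

end HilbertTensorInstances

/-- The operator `S ⊗ T` on the Hilbert space tensor product, `(S ⊗ T)(x ⊗ y) = S x ⊗ T y`. -/
noncomputable def tensorOp (S : H →L[ℂ] H) (T : K →L[ℂ] K) :
    HilbertTensor H K →L[ℂ] HilbertTensor H K :=
  show UniformSpace.Completion (H ⊗[ℂ] K) →L[ℂ] UniformSpace.Completion (H ⊗[ℂ] K) from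
    (TensorProduct.mapL S T).completion

/-- The spatial tensor product of `A` and `B` for (faithful) representations `π` on `H` and `ρ` on
`K`: the C*-algebra of operators on the Hilbert space tensor product of `H` and `K` generated by the
`π a ⊗ ρ b`, that is, the norm closure of the *-algebra generated by them, which is their linear
span. -/
noncomputable def spatialTensorProduct (π : A →⋆ₙₐ[ℂ] (H →L[ℂ] H)) (ρ : B →⋆ₙₐ[ℂ] (K →L[ℂ] K)) :
    NonUnitalStarSubalgebra ℂ (HilbertTensor H K →L[ℂ] HilbertTensor H K) :=
  (NonUnitalStarAlgebra.adjoin ℂ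
    (Set.range fun p : A × B => tensorOp (π p.1) (ρ p.2))).topologicalClosure

end SpatialTensorProduct

section MinimalTensorProduct

attribute [local instance] CStarAlgebra.spectralOrder CStarAlgebra.spectralOrderedRing

/-- The minimal C*-tensor product `A ⊗_min B`: the spatial tensor product for the universal
representations of `A` and `B`, which are faithful. -/
def MinTensorProduct (A B : Type*) [NonUnitalCStarAlgebra A] [NonUnitalCStarAlgebra B] : Type _ :=
  spatialTensorProduct (universalRep A) (universalRep B)

noncomputable instance (A B : Type*) [NonUnitalCStarAlgebra A] [NonUnitalCStarAlgebra B] :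
    NonUnitalCStarAlgebra (MinTensorProduct A B) :=
  NonUnitalStarSubalgebra.nonUnitalCStarAlgebra
    (spatialTensorProduct (universalRep A) (universalRep B))
    (h_closed := NonUnitalStarSubalgebra.isClosed_topologicalClosure _)

end MinimalTensorProduct

/-! Any sequence `a n` in a `Z*` algebra has a common nonzero left annihilator: after rescaling to
`x n`, the series `∑ x n * star (x n)` converges to a positive `h`, and a nonzero `c` with `c * h =
0` kills every `x n`, because each term of the series is at most `h`.

An element `T` of the spatial tensor product is a norm limit of a sequence from the *-algebra
generated by elementary tensors, so it involves only countably many elements of `A`. If `c ≠ 0`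
annihilates all of them and `b ≠ 0` in `B`, then `π c ⊗ ρ b` annihilates `T` from the left, and it
is nonzero because `π` and `ρ` are faithful. Positivity of `T` plays no role. -/

/-! ### Common annihilators of sequences -/

section CommonAnnihilator

attribute [local instance] CStarAlgebra.spectralOrder CStarAlgebra.spectralOrderedRing

/-- In a `Z*` algebra every positive element has a nonzero left annihilator. -/
lemma IsZStarAlgebra.exists_mul_eq_zero {A : Type*} [NonUnitalCStarAlgebra A]
    (hA : IsZStarAlgebra A) {h : A} (hh : 0 ≤ h) : ∃ c : A, c ≠ 0 ∧ c * h = 0 := by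
  obtain ⟨c, hc, h1 | h1⟩ := hA h hh
  · refine ⟨star c, star_ne_zero.mpr hc, ?_⟩
    rw [← (IsSelfAdjoint.of_nonneg hh).star_eq, ← star_mul, h1, star_zero]
  · exact ⟨c, hc, h1⟩

/-- If `a * star a ≤ h`, then every left annihilator of `h` is a left annihilator of `a`. -/
lemma mul_eq_zero_of_mul_star_self_le {A : Type*} [NonUnitalCStarAlgebra A] {a h c : A}
    (hle : a * star a ≤ h) (hc : c * h = 0) : c * a = 0 := by
  -- Conjugating by `c` gives `(c * a) * star (c * a) ≤ c * h * star c = 0`.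
  have h1 := star_right_conjugate_le_conjugate hle c
  rw [hc, zero_mul] at h1
  have h2 : c * (a * star a) * star c = (c * a) * star (c * a) := by
    simp only [star_mul, mul_assoc]
  rw [h2] at h1
  exact (CStarRing.mul_star_self_eq_zero_iff _).mp (le_antisymm h1 (mul_star_self_nonneg _))

/-- A sequence in a `Z*` algebra has a common nonzero left annihilator. -/
lemma IsZStarAlgebra.exists_forall_mul_eq_zero {A : Type*} [NonUnitalCStarAlgebra A]
    (hA : IsZStarAlgebra A) (a : ℕ → A) : ∃ c : A, c ≠ 0 ∧ ∀ n, c * a n = 0 := by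
  -- Positive weights, cancellable at the end, that force `‖x n‖ ≤ 2⁻ⁿ`; the `1 +` guards against `a
  -- n = 0`.
  let w : ℕ → ℝ := fun n => (1 / 2) ^ n / (1 + ‖a n‖)
  have hw : ∀ n, 0 < w n := fun n => by positivity
  let x : ℕ → A := fun n => w n • a n
  have hx : ∀ n, ‖x n‖ ≤ (1 / 2) ^ n := fun n => by
    rw [norm_smul, Real.norm_of_nonneg (hw n).le, div_mul_eq_mul_div, div_le_iff₀ (by positivity)]
    gcongr
    linarith
  have hsum : Summable fun n => x n * star (x n) := by
    refine .of_norm_bounded (g := fun n => (1 / 2 : ℝ) ^ n) summable_geometric_two fun n => ?_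
    rw [CStarRing.norm_self_mul_star]
    calc ‖x n‖ * ‖x n‖ ≤ (1 / 2) ^ n * 1 := by
          gcongr
          · exact hx n
          · exact (hx n).trans (pow_le_one₀ (by norm_num) (by norm_num))
      _ = (1 / 2) ^ n := mul_one _
  obtain ⟨c, hc, h0⟩ := hA.exists_mul_eq_zero
    (tsum_nonneg fun n => mul_star_self_nonneg (x n))
  refine ⟨c, hc, fun n => ?_⟩
  have h1 := mul_eq_zero_of_mul_star_self_le
    (hsum.le_tsum n fun m _ => mul_star_self_nonneg (x m)) h0
  rw [mul_smul_comm] at h1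
  exact (smul_eq_zero.mp h1).resolve_left (hw n).ne'

end CommonAnnihilator

/-! ### Algebra of the operators `S ⊗ T` -/

section TensorOp

section Coe

variable {H K : Type*} [NormedAddCommGroup H] [InnerProductSpace ℂ H]
  [NormedAddCommGroup K] [InnerProductSpace ℂ K]

/-- The inclusion of the algebraic tensor product into the Hilbert space tensor product. -/
noncomputable def HilbertTensor.ofTensor (z : H ⊗[ℂ] K) : HilbertTensor H K :=
  (z : UniformSpace.Completion (H ⊗[ℂ] K))

lemma HilbertTensor.denseRange_ofTensor :
    DenseRange (HilbertTensor.ofTensor : H ⊗[ℂ] K → HilbertTensor H K) :=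
  UniformSpace.Completion.denseRange_coe

lemma HilbertTensor.norm_ofTensor (z : H ⊗[ℂ] K) : ‖HilbertTensor.ofTensor z‖ = ‖z‖ :=
  UniformSpace.Completion.norm_coe z

lemma HilbertTensor.inner_ofTensor (z w : H ⊗[ℂ] K) :
    inner ℂ (HilbertTensor.ofTensor z) (HilbertTensor.ofTensor w) = inner ℂ z w :=
  UniformSpace.Completion.inner_coe z w

lemma tensorOp_ofTensor (S : H →L[ℂ] H) (T : K →L[ℂ] K) (z : H ⊗[ℂ] K) :
    tensorOp S T (.ofTensor z) = .ofTensor (TensorProduct.mapL S T z) :=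
  ContinuousLinearMap.completion_apply_coe _ z

/-- Operators on the Hilbert space tensor product agree if they agree on the algebraic one. -/
lemma HilbertTensor.clm_ext {S T : HilbertTensor H K →L[ℂ] HilbertTensor H K}
    (h : ∀ z : H ⊗[ℂ] K, S (.ofTensor z) = T (.ofTensor z)) : S = T :=
  DFunLike.coe_injective <|
    HilbertTensor.denseRange_ofTensor.equalizer S.continuous T.continuous (funext h)

lemma tensorOp_mul (S S' : H →L[ℂ] H) (T T' : K →L[ℂ] K) :
    tensorOp S T * tensorOp S' T' = tensorOp (S * S') (T * T') := by
  refine HilbertTensor.clm_ext fun z => ?_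
  rw [mul_apply_eq_comp, tensorOp_ofTensor, tensorOp_ofTensor, tensorOp_ofTensor,
    TensorProduct.mapL_mul, mul_apply_eq_comp]

lemma tensorOp_zero_left (T : K →L[ℂ] K) : tensorOp (0 : H →L[ℂ] H) T = 0 := by
  refine HilbertTensor.clm_ext fun z => ?_
  rw [tensorOp_ofTensor, TensorProduct.mapL_zero_left, zero_apply, zero_apply,
    ← norm_eq_zero, HilbertTensor.norm_ofTensor, norm_zero]

/-- The norm is multiplicative on elementary tensors, so `x ⊗ y` is not killed when `S x ≠ 0` and `T
y ≠ 0`. -/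
lemma tensorOp_ne_zero {S : H →L[ℂ] H} {T : K →L[ℂ] K} (hS : S ≠ 0) (hT : T ≠ 0) :
    tensorOp S T ≠ 0 := by
  obtain ⟨x, hx⟩ := DFunLike.ne_iff.mp hS
  obtain ⟨y, hy⟩ := DFunLike.ne_iff.mp hT
  intro h
  have h1 := congrArg norm (DFunLike.congr_fun h (HilbertTensor.ofTensor (x ⊗ₜ y)))
  rw [tensorOp_ofTensor, HilbertTensor.norm_ofTensor, TensorProduct.mapL_tmul,
    TensorProduct.norm_tmul, zero_apply, norm_zero] at h1
  exact mul_ne_zero (norm_ne_zero_iff.mpr hx) (norm_ne_zero_iff.mpr hy) h1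

end Coe

variable {H K : Type*} [NormedAddCommGroup H] [InnerProductSpace ℂ H] [CompleteSpace H]
  [NormedAddCommGroup K] [InnerProductSpace ℂ K] [CompleteSpace K]

/-- The adjoint identity on the algebraic tensor product, where induction on tensors applies;
density then carries it to the completion. -/
lemma inner_mapL_star (S : H →L[ℂ] H) (T : K →L[ℂ] K) (z w : H ⊗[ℂ] K) :
    inner ℂ (TensorProduct.mapL (star S) (star T) z) w =
      inner ℂ z (TensorProduct.mapL S T w) := by
  induction z with
  | zero => simp
  | add z z' hz hz' => rw [map_add, inner_add_left, inner_add_left, hz, hz']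
  | tmul x y =>
    induction w with
    | zero => simp
    | add w w' hw hw' => rw [map_add, inner_add_right, inner_add_right, hw, hw']
    | tmul x' y' =>
      simp only [TensorProduct.mapL_tmul, TensorProduct.inner_tmul,
        ContinuousLinearMap.star_eq_adjoint, ContinuousLinearMap.adjoint_inner_left]

lemma star_tensorOp (S : H →L[ℂ] H) (T : K →L[ℂ] K) :
    star (tensorOp S T) = tensorOp (star S) (star T) := by
  rw [ContinuousLinearMap.star_eq_adjoint, eq_comm, ContinuousLinearMap.eq_adjoint_iff]
  intro x y
  refine HilbertTensor.denseRange_ofTensor.induction_on₂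
    (p := fun x y => inner ℂ (tensorOp (star S) (star T) x) y = inner ℂ x (tensorOp S T y))
    (isClosed_eq (by fun_prop) (by fun_prop)) (fun z w => ?_) x y
  rw [tensorOp_ofTensor, tensorOp_ofTensor, HilbertTensor.inner_ofTensor,
    HilbertTensor.inner_ofTensor, inner_mapL_star]

end TensorOp

/-! ### Countable support in the left factor -/

section LeftAnnihilator

variable {A B : Type*} [NonUnitalCStarAlgebra A] [NonUnitalCStarAlgebra B]
variable {H K : Type*} [NormedAddCommGroup H] [InnerProductSpace ℂ H] [CompleteSpace H]
  [NormedAddCommGroup K] [InnerProductSpace ℂ K] [CompleteSpace K]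

/-- `T` is annihilated from the left by `π c ⊗ ρ b` whenever `c` annihilates the set `s`. -/
def IsAnnihilatedVia (π : A →⋆ₙₐ[ℂ] (H →L[ℂ] H)) (ρ : B →⋆ₙₐ[ℂ] (K →L[ℂ] K)) (s : Set A)
    (T : HilbertTensor H K →L[ℂ] HilbertTensor H K) : Prop :=
  ∀ c : A, (∀ a ∈ s, c * a = 0) → ∀ b : B, tensorOp (π c) (ρ b) * T = 0

/-- A larger set leaves fewer `c` to test, so the sets of several operators may be merged into their
union. -/
lemma IsAnnihilatedVia.mono {π : A →⋆ₙₐ[ℂ] (H →L[ℂ] H)} {ρ : B →⋆ₙₐ[ℂ] (K →L[ℂ] K)}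
    {s s' : Set A} {T : HilbertTensor H K →L[ℂ] HilbertTensor H K}
    (h : IsAnnihilatedVia π ρ s T) (hs : s ⊆ s') : IsAnnihilatedVia π ρ s' T :=
  fun c hc b => h c (fun a ha => hc a (hs ha)) b

lemma isAnnihilatedVia_tensorOp (π : A →⋆ₙₐ[ℂ] (H →L[ℂ] H)) (ρ : B →⋆ₙₐ[ℂ] (K →L[ℂ] K))
    (a : A) (T : K →L[ℂ] K) : IsAnnihilatedVia π ρ {a} (tensorOp (π a) T) := fun c hc b => by
  rw [tensorOp_mul, ← map_mul, hc a rfl, map_zero, tensorOp_zero_left]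

/-- The elements of the *-algebra generated by the elementary tensors only involve countably many
elements of the left factor. -/
lemma exists_countable_isAnnihilatedVia_of_mem_adjoin (π : A →⋆ₙₐ[ℂ] (H →L[ℂ] H))
    (ρ : B →⋆ₙₐ[ℂ] (K →L[ℂ] K)) {T : HilbertTensor H K →L[ℂ] HilbertTensor H K}
    (hT : T ∈ NonUnitalStarAlgebra.adjoin ℂ
      (Set.range fun p : A × B => tensorOp (π p.1) (ρ p.2))) :
    ∃ s : Set A, s.Countable ∧ IsAnnihilatedVia π ρ s T ∧ IsAnnihilatedVia π ρ s (star T) := by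
  -- Left annihilation of `T` says nothing about `star T`; carrying both makes the claim stable
  -- under `star`.
  induction hT using NonUnitalStarAlgebra.adjoin_induction with
  | mem T hT =>
    obtain ⟨⟨a, b⟩, rfl⟩ := hT
    refine ⟨{a, star a}, by simp, ?_, ?_⟩
    · exact (isAnnihilatedVia_tensorOp π ρ a (ρ b)).mono (by simp)
    · dsimp only
      rw [star_tensorOp, ← map_star]
      exact (isAnnihilatedVia_tensorOp π ρ (star a) _).mono (by simp)
  | zero => exact ⟨∅, Set.countable_empty, fun c _ b => mul_zero _, fun c _ b => by simp⟩
  | add T T' _ _ h h' =>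
    obtain ⟨s, hs, h1, h2⟩ := h
    obtain ⟨s', hs', h1', h2'⟩ := h'
    refine ⟨s ∪ s', hs.union hs', fun c hc b => ?_, fun c hc b => ?_⟩
    · rw [mul_add, h1.mono Set.subset_union_left c hc, h1'.mono Set.subset_union_right c hc,
        add_zero]
    · rw [star_add, mul_add, h2.mono Set.subset_union_left c hc,
        h2'.mono Set.subset_union_right c hc, add_zero]
  | mul T T' _ _ h h' =>
    obtain ⟨s, hs, h1, h2⟩ := h
    obtain ⟨s', hs', h1', h2'⟩ := h'
    refine ⟨s ∪ s', hs.union hs', fun c hc b => ?_, fun c hc b => ?_⟩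
    · rw [← mul_assoc, h1.mono Set.subset_union_left c hc, zero_mul]
    · rw [star_mul, ← mul_assoc, h2'.mono Set.subset_union_right c hc, zero_mul]
  | smul r T _ h =>
    obtain ⟨s, hs, h1, h2⟩ := h
    refine ⟨s, hs, fun c hc b => ?_, fun c hc b => ?_⟩
    · rw [mul_smul_comm, h1 c hc, smul_zero]
    · rw [star_smul, mul_smul_comm, h2 c hc, smul_zero]
  | star T _ h =>
    obtain ⟨s, hs, h1, h2⟩ := h
    exact ⟨s, hs, h2, by rwa [star_star]⟩

/-- The elements of the spatial tensor product only involve countably many elements of the left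
factor. -/
lemma exists_countable_isAnnihilatedVia (π : A →⋆ₙₐ[ℂ] (H →L[ℂ] H))
    (ρ : B →⋆ₙₐ[ℂ] (K →L[ℂ] K)) {T : HilbertTensor H K →L[ℂ] HilbertTensor H K}
    (hT : T ∈ spatialTensorProduct π ρ) :
    ∃ s : Set A, s.Countable ∧ IsAnnihilatedVia π ρ s T := by
  obtain ⟨u, hu, hlim⟩ := mem_closure_iff_seq_limit.mp hT
  choose s hs h _ using fun n => exists_countable_isAnnihilatedVia_of_mem_adjoin π ρ (hu n)
  refine ⟨⋃ n, s n, Set.countable_iUnion hs, fun c hc b => ?_⟩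
  -- The products with the approximants `u n` are all zero, and they converge to the product with
  -- `T`.
  refine tendsto_nhds_unique (hlim.const_mul (tensorOp (π c) (ρ b))) ?_
  simp only [(h _).mono (Set.subset_iUnion s _) c hc b, tendsto_const_nhds]

lemma tensorOp_mem_spatialTensorProduct (π : A →⋆ₙₐ[ℂ] (H →L[ℂ] H))
    (ρ : B →⋆ₙₐ[ℂ] (K →L[ℂ] K)) (a : A) (b : B) :
    tensorOp (π a) (ρ b) ∈ spatialTensorProduct π ρ :=
  NonUnitalStarSubalgebra.le_topologicalClosure _
    (NonUnitalStarAlgebra.subset_adjoin ℂ _ ⟨(a, b), rfl⟩)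

/-- Every element of the spatial tensor product of a `Z*` algebra with a nonzero C*-algebra, for
faithful representations, is annihilated from the left by a nonzero elementary tensor. -/
lemma IsZStarAlgebra.exists_mem_spatialTensorProduct_mul_eq_zero [Nontrivial B]
    (hA : IsZStarAlgebra A) {π : A →⋆ₙₐ[ℂ] (H →L[ℂ] H)} {ρ : B →⋆ₙₐ[ℂ] (K →L[ℂ] K)}
    (hπ : Function.Injective π) (hρ : Function.Injective ρ)
    {T : HilbertTensor H K →L[ℂ] HilbertTensor H K} (hT : T ∈ spatialTensorProduct π ρ) :
    ∃ S ∈ spatialTensorProduct π ρ, S ≠ 0 ∧ S * T = 0 := by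
  obtain ⟨s, hs, h⟩ := exists_countable_isAnnihilatedVia π ρ hT
  -- Adding `0` imposes no condition on `c` and makes the set nonempty, hence the range of a
  -- sequence.
  obtain ⟨a, ha⟩ := (hs.insert 0).exists_eq_range (Set.insert_nonempty 0 s)
  obtain ⟨c, hc, hca⟩ := hA.exists_forall_mul_eq_zero a
  obtain ⟨b, hb⟩ := exists_ne (0 : B)
  refine ⟨tensorOp (π c) (ρ b), tensorOp_mem_spatialTensorProduct π ρ c b,
    tensorOp_ne_zero ((map_ne_zero_iff π hπ).mpr hc) ((map_ne_zero_iff ρ hρ).mpr hb),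
    h c (fun x hx => ?_) b⟩
  obtain ⟨n, rfl⟩ : x ∈ Set.range a := ha ▸ Set.mem_insert_of_mem 0 hx
  exact hca n

end LeftAnnihilator

/-- A norm closed *-algebra of operators in which every element has a nonzero left annihilator is
a `Z*` algebra. -/
lemma isZStarAlgebra_of_forall_exists_mul_eq_zero {E : Type*} [NonUnitalCStarAlgebra E]
    (S : NonUnitalStarSubalgebra ℂ E) [h_closed : IsClosed (S : Set E)]
    (h : ∀ t ∈ S, ∃ s ∈ S, s ≠ 0 ∧ s * t = 0) :
    @IsZStarAlgebra S (NonUnitalStarSubalgebra.nonUnitalCStarAlgebra S) := by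
  intro t _
  obtain ⟨s, hs, hs0, hst⟩ := h t t.2
  exact ⟨⟨s, hs⟩, fun h => hs0 (congrArg Subtype.val h), Or.inr (Subtype.ext hst)⟩

/-! ### The universal representations -/

section MinTensor

attribute [local instance] CStarAlgebra.spectralOrder CStarAlgebra.spectralOrderedRing

lemma IsZStarAlgebra.exists_mem_universal_mul_eq_zero {A : Type*} (B : Type*)
    [NonUnitalCStarAlgebra A] [NonUnitalCStarAlgebra B] [Nontrivial B] (hA : IsZStarAlgebra A) :
    ∀ T ∈ spatialTensorProduct (universalRep A) (universalRep B),
      ∃ S ∈ spatialTensorProduct (universalRep A) (universalRep B), S ≠ 0 ∧ S * T = 0 :=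
  fun _ hT => hA.exists_mem_spatialTensorProduct_mul_eq_zero
    (universalRep_injective A) (universalRep_injective B) hT

lemma IsZStarAlgebra.spatialTensorProduct_universalRep {A : Type*} (B : Type*)
    [NonUnitalCStarAlgebra A] [NonUnitalCStarAlgebra B] [Nontrivial B] (hA : IsZStarAlgebra A) :
    @IsZStarAlgebra (spatialTensorProduct (universalRep A) (universalRep B))
      (NonUnitalStarSubalgebra.nonUnitalCStarAlgebra
        (spatialTensorProduct (universalRep A) (universalRep B))
        (h_closed := NonUnitalStarSubalgebra.isClosed_topologicalClosure _)) :=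
  isZStarAlgebra_of_forall_exists_mul_eq_zero
    (spatialTensorProduct (universalRep A) (universalRep B))
    (h_closed := NonUnitalStarSubalgebra.isClosed_topologicalClosure _)
    (hA.exists_mem_universal_mul_eq_zero B)

end MinTensor

theorem proposition3 (A B : Type*) [NonUnitalCStarAlgebra A] [NonUnitalCStarAlgebra B]
    [Nontrivial B] (hA : IsZStarAlgebra A) :
    IsZStarAlgebra (MinTensorProduct A B) :=
  hA.spatialTensorProduct_universalRep B
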